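/- Let $H$ be a complex Hilbert space and let $\mathcal L_0$ be a subspace lattice on $H$, that is, a set of closed subspaces of $H$ containing $\{0\}$ and $H$ and closed under arbitrary closed linear spans and arbitrary intersections. For a subspace lattice $\mathcal L$, let $\mathrm{Alg}\,\mathcal L$ be the algebra of all bounded operators leaving every member of $\mathcal L$ invariant, and assume that $\mathcal L_0$ is reflexive, i.e. $\mathcal L_0$ is the set of all closed subspaces invariant under every operator in $\mathrm{Alg}\,\mathcal L_0$. For $P\in\mathcal L_0$ let $P_-$ be the closed linear span of all $Q\in\mathcal L_0$ with $Q\not\supseteq P$ (so $0_-=0$). Assume that (a) $\mathrm{Alg}\,\mathcal L_0$ is decomposable, i.e. every finite-rank operator in $\mathrm{Alg}\,\mathcal L_0$ is a finite sum of rank-one operators in $\mathrm{Alg}\,\mathcal L_0$; (b) the linear span of the rank-one operators in $\mathrm{Alg}\,\mathcal L_0$ is contained in the linear span of the idempotents in $\mathrm{Alg}\,\mathcal L_0$; (c) for no nonzero $P\in\mathcal L_0$ is $P$ a proper subspace of $P_-$ (that is, $P\nless P_-$). Let $(\mathscr K,\mathcal L)$ be either of the following: (i) $\mathscr K$ is the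 direct sum of $n_0\ge 2$ copies of $H$, $\zeta=(a_1,\dots,a_{n_0})\in\mathbb C^{n_0}$ is a unit vector with all $a_i\ne 0$, and $\mathcal L=\mathcal L_{n_0}$ is the subspace lattice generated by the subspaces $P\oplus 0\oplus\cdots\oplus 0$ ($P\in\mathcal L_0$), the subspace $\{(a_1x,\dots,a_{n_0}x):x\in H\}$, and the sums $F_k$ of the first $k$ summands, $2\le k\le n_0$; (ii) $\mathscr K$ is the Hilbert space direct sum of countably infinitely many copies of $H$ indexed by $n\ge 1$, $\eta=(b_1,b_2,\dots)\in\ell^2(\mathbb N)$ is a unit vector with all $b_n\ne 0$, and $\mathcal L=\mathcal L_\infty$ is the subspace lattice generated by the subspaces $P\oplus 0\oplus 0\oplus\cdots$ ($P\in\mathcal L_0$), the subspace $\{(b_1x,b_2x,\dots):x\in H\}$, and the sums $F_k$ of the first $k$ summands, $k\ge 2$. A derivation from $\mathrm{Alg}\,\mathcal L$ into $\mathcal B(\mathscr K)$ is a linear map $D$ with $D(AB)=D(A)B+AD(B)$ for all $A,B\in\mathrm{Alg}\,\mathcal L$; a local derivation is a linear map $\delta:\mathrm{Alg}\,\mathcal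 L\to\mathcal B(\mathscr K)$ such that for every $A\in\mathrm{Alg}\,\mathcal L$ there is a derivation $D_A$ from $\mathrm{Alg}\,\mathcal L$ into $\mathcal B(\mathscr K)$ with $\delta(A)=D_A(A)$. (No continuity is assumed of derivations or local derivations.) Then every local derivation from $\mathrm{Alg}\,\mathcal L$ into $\mathcal B(\mathscr K)$ is a derivation. -/

import Mathlib

namespace LocalDer

open scoped ENNReal

section Lattices

variable {H : Type*} [NormedAddCommGroup H] [InnerProductSpace ℂ H]

/-- A subspace lattice: a set of closed subspaces containing `0` and the whole space and closed
under arbitrary closed linear spans (`sSup`) and arbitrary intersections (`sInf`). -/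
structure IsSubspaceLattice (L : Set (ClosedSubmodule ℂ H)) : Prop where
  bot_mem : ⊥ ∈ L
  top_mem : ⊤ ∈ L
  sSup_mem : ∀ S ⊆ L, sSup S ∈ L
  sInf_mem : ∀ S ⊆ L, sInf S ∈ L

/-- The subspace lattice generated by a set of closed subspaces: the smallest one containing it. -/
def generatedLattice (G : Set (ClosedSubmodule ℂ H)) : Set (ClosedSubmodule ℂ H) :=
  ⋂₀ {L | IsSubspaceLattice L ∧ G ⊆ L}

/-- `Alg L`: the bounded operators that leave every member of `L` invariant. -/
def Alg (L : Set (ClosedSubmodule ℂ H)) : Subalgebra ℂ (H →L[ℂ] H) where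
  carrier := {A | ∀ E ∈ L, ∀ x ∈ E, A x ∈ E}
  mul_mem' := fun hA hB E hE x hx => hA E hE _ (hB E hE x hx)
  add_mem' := fun hA hB E hE x hx => E.toSubmodule.add_mem (hA E hE x hx) (hB E hE x hx)
  algebraMap_mem' := fun c E _ x hx => by
    simpa [Algebra.algebraMap_eq_smul_one] using E.toSubmodule.smul_mem c hx

/-- `Lat 𝒜`: the closed subspaces that are invariant under every operator in `𝒜`. -/
def Lat (𝒜 : Subalgebra ℂ (H →L[ℂ] H)) : Set (ClosedSubmodule ℂ H) :=
  {E | ∀ A ∈ 𝒜, ∀ x ∈ E, A x ∈ E}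

/-- A lattice is reflexive if `L = Lat (Alg L)`. -/
def IsReflexiveLattice (L : Set (ClosedSubmodule ℂ H)) : Prop :=
  L = Lat (Alg L)

/-- The immediate predecessor `P₋ = ⋁ {Q ∈ L | Q ≱ P}` of `P` in `L`
(for `P = 0` the set is empty and the value is `0`). -/
noncomputable def predecessor (L : Set (ClosedSubmodule ℂ H)) (P : ClosedSubmodule ℂ H) :
    ClosedSubmodule ℂ H :=
  sSup {Q | Q ∈ L ∧ ¬ P ≤ Q}

/-- The linear span of the operators of rank one in `𝒜`. -/
def rankOneSpan (𝒜 : Subalgebra ℂ (H →L[ℂ] H)) : Submodule ℂ (H →L[ℂ] H) :=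
  Submodule.span ℂ {T | T ∈ 𝒜 ∧ Module.finrank ℂ (LinearMap.range (T : H →ₗ[ℂ] H)) = 1}

/-- The linear span of the idempotents in `𝒜`. -/
def idempotentSpan (𝒜 : Subalgebra ℂ (H →L[ℂ] H)) : Submodule ℂ (H →L[ℂ] H) :=
  Submodule.span ℂ {T | T ∈ 𝒜 ∧ IsIdempotentElem T}

/-- `𝒜` is decomposable: every finite-rank operator in `𝒜` is a finite sum of rank-one operators
in `𝒜`. (Scalar multiples are harmless: nonzero multiples of rank-one operators in `𝒜` are again
rank-one operators in `𝒜`.) -/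
def IsDecomposable (𝒜 : Subalgebra ℂ (H →L[ℂ] H)) : Prop :=
  ∀ T ∈ 𝒜, FiniteDimensional ℂ (LinearMap.range (T : H →ₗ[ℂ] H)) → T ∈ rankOneSpan 𝒜

/-- A derivation from `𝒜` into `B(H)`; no continuity is required. -/
def IsDerivation {𝒜 : Subalgebra ℂ (H →L[ℂ] H)} (D : 𝒜 →ₗ[ℂ] (H →L[ℂ] H)) : Prop :=
  ∀ A B : 𝒜, D (A * B) = D A * (B : H →L[ℂ] H) + (A : H →L[ℂ] H) * D B

/-- A linear map from `𝒜` into `B(H)` that agrees at each element with some derivation. -/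
def IsLocalDerivation {𝒜 : Subalgebra ℂ (H →L[ℂ] H)} (δ : 𝒜 →ₗ[ℂ] (H →L[ℂ] H)) : Prop :=
  ∀ A : 𝒜, ∃ D : 𝒜 →ₗ[ℂ] (H →L[ℂ] H), IsDerivation D ∧ δ A = D A

end Lattices

section DirectSum

variable {ι : Type*} {H : Type*} [NormedAddCommGroup H] [InnerProductSpace ℂ H]

/-- The Hilbert space direct sum of copies of `H` indexed by `ι` (for finite `ι` this consists of
all families). -/
abbrev Copies (ι : Type*) (H : Type*) [NormedAddCommGroup H] : Type _ :=
  lp (fun _ : ι => H) 2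

/-- `E₁₁ ⊗ P`: the copy of `P` in the `i₀`-th summand. -/
noncomputable def firstCopy (i₀ : ι) (P : ClosedSubmodule ℂ H) : ClosedSubmodule ℂ (Copies ι H) where
  carrier := {v | v i₀ ∈ P ∧ ∀ j, j ≠ i₀ → v j = 0}
  add_mem' := fun {v w} hv hw =>
    ⟨P.toSubmodule.add_mem hv.1 hw.1, fun j hj => by simp [hv.2 j hj, hw.2 j hj]⟩
  zero_mem' := ⟨P.toSubmodule.zero_mem, fun _ _ => rfl⟩
  smul_mem' := fun c v hv =>
    ⟨P.toSubmodule.smul_mem c hv.1, fun j hj => by simp [hv.2 j hj]⟩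
  isClosed' := by
    have hc : ∀ i : ι, Continuous fun v : Copies ι H => v i := fun i =>
      (lp.evalCLM ℂ (fun _ : ι => H) 2 i).continuous
    have h1 : IsClosed {v : Copies ι H | v i₀ ∈ P} := P.isClosed.preimage (hc i₀)
    have h2 : IsClosed {v : Copies ι H | ∀ j, j ≠ i₀ → v j = 0} := by
      simp only [Set.ofPred_forall]
      exact isClosed_iInter fun j => isClosed_iInter fun _ =>
        isClosed_eq (hc j) continuous_const
    exact h1.inter h2

/-- The range of `Q_ζ`: the closed subspace spanned by the vectors `(ζ i • x)_i`, `x ∈ H`. -/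
noncomputable def diagonal (ζ : ι → ℂ) : ClosedSubmodule ℂ (Copies ι H) :=
  (Submodule.span ℂ {v : Copies ι H | ∃ x : H, ∀ i, v i = ζ i • x}).closure

/-- The sum of the summands with index at most `k`. -/
noncomputable def initialSum [LinearOrder ι] (k : ι) : ClosedSubmodule ℂ (Copies ι H) where
  carrier := {v | ∀ j, k < j → v j = 0}
  add_mem' := fun {v w} hv hw j hj => by simp [hv j hj, hw j hj]
  zero_mem' := fun _ _ => rfl
  smul_mem' := fun c v hv j hj => by simp [hv j hj]
  isClosed' := by
    have hc : ∀ i : ι, Continuous fun v : Copies ι H => v i := fun i =>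
      (lp.evalCLM ℂ (fun _ : ι => H) 2 i).continuous
    have h2 : IsClosed {v : Copies ι H | ∀ j, k < j → v j = 0} := by
      simp only [Set.ofPred_forall]
      exact isClosed_iInter fun j => isClosed_iInter fun _ =>
        isClosed_eq (hc j) continuous_const
    exact h2

/-- The lattice generated by all `E₁₁ ⊗ P` (`P ∈ L₀`), by `Q_ζ`, and by the sums `F_k` of the first
`k` summands, `k ≥ 2`. Here `i₀` is the first index, so `F_k` with `k ≥ 2` is `initialSum k` for an
index `k > i₀`. -/
def copiesLattice [LinearOrder ι] (i₀ : ι) (ζ : ι → ℂ) (L₀ : Set (ClosedSubmodule ℂ H)) :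
    Set (ClosedSubmodule ℂ (Copies ι H)) :=
  generatedLattice
    (firstCopy i₀ '' L₀ ∪ {diagonal ζ} ∪ {E | ∃ k : ι, i₀ < k ∧ E = initialSum k})

end DirectSum

end LocalDer

/-!
Write `F_k` for the sum of the summands up to the `k`-th, "diagonal" for the subspace of the vectors
`(ζ i • x)_i`, and `M(a, k) = δ(ak) - δ(a)k - aδ(k)` for the defect of a local derivation `δ` on the
algebra `𝒜` of the lattice on the direct sum.

Locality gives `a δ(b) c = 0` whenever `ab = 0 = bc`. For idempotents `p`, `q` this yields
`δ(paq) = δ(pa)q + pδ(aq) - pδ(a)q` (`IsLocalDerivation.map_mul_mul`), which extends to the linear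
span `E` of the idempotents. Hence `M` vanishes on `E × E`, and `p M(a, k) = M(pa, k)` for
`p, k ∈ E`. It suffices to prove `M(a, k) = 0` for all `a` and all `k` in a left ideal contained in
`E` with total range (`isDerivation_of_defect_eq_zero`).

Most rank-one operators in `𝒜` are the `u ⊗ φ` with `u ∈ F_l` and `φ` vanishing on the diagonal, on
`F_1`, and on the `F_k` with `k < l`. They lie in `E`, because `φ` does not vanish on some `u'` for
which `u' ⊗ φ ∈ 𝒜` (`KillsBelow.smulRight_mem_idempotentSpan`). The rank-one operators with
`u = (x, 0, …)` and `x ⊗ φ₁ ∈ Alg L₀` lie in `E` by the hypothesis on `Alg L₀`: an idempotent `e` of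
`Alg L₀` lifts to an idempotent of `𝒜` with first row `(e, -(ζ₁ / ζ₂) e, 0, …)`. If the index set has
a last element, there are also operators with `u` in the diagonal.

The hypothesis on predecessors enters twice. It forces `⋂ P₋ = 0` over `P ≠ 0`
(`sInf_predecessor_eq_bot`), so that the functionals `φ` above have only the diagonal as common
kernel, and it forces the `P` with `P₋ ≠ H` to span `H` (`sSup_predecessor_ne_top_eq_top`), so that
the vectors `u` are total. Consequently `M(a, k)` always has range in the diagonal.

For infinitely many summands rank-one operators do not detect diagonal vectors, and `𝒜` need not
have enough idempotents of infinite rank. The operators `A(T)`, which act as `T` on every coordinate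
but the first, do detect them, and `A(T) M(a, k) = M(A(T)a, k)` for `T` of rank one. Modulo `E`, the
operator `A(T)a` equals some `c` that annihilates the diagonal, and any finite number of rows of such
a `c` is a sum of rank-one operators in `E`. If `k` has range in `F_m`, deleting the rows of `c` up
to the `m`-th gives `ck = 0`; then `δ(c) = D(c)` for a derivation `D` shows that
`M(c, k) = c (D(k) - δ(k))` has vanishing first coordinate. A diagonal vector with vanishing first
coordinate is zero (`IsLocalDerivation.defect_eq_zero_of_range_subset_initialSum`).
-/

namespace LocalDer

/-! ### Local derivations and idempotents -/

section LocalDerivations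

variable {K : Type*} [NormedAddCommGroup K] [InnerProductSpace ℂ K]
  {𝒜 : Subalgebra ℂ (K →L[ℂ] K)} {δ : 𝒜 →ₗ[ℂ] (K →L[ℂ] K)}

theorem mem_idempotentSpan_iff (p : 𝒜) :
    (p : K →L[ℂ] K) ∈ idempotentSpan 𝒜 ↔ p ∈ Submodule.span ℂ {q : 𝒜 | IsIdempotentElem q} := by
  have h : idempotentSpan 𝒜 =
      (Submodule.span ℂ {q : 𝒜 | IsIdempotentElem q}).map 𝒜.val.toLinearMap := by
    rw [Submodule.map_span, idempotentSpan]
    congr 1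
    ext T
    constructor
    · rintro ⟨hT, hi⟩
      exact ⟨⟨T, hT⟩, Subtype.ext hi, rfl⟩
    · rintro ⟨q, hq, rfl⟩
      exact ⟨q.2, congrArg Subtype.val hq⟩
  rw [h]
  constructor
  · rintro ⟨q, hq, hqp⟩
    rwa [← Subtype.ext hqp]
  · intro hp
    exact ⟨p, hp, rfl⟩

theorem idempotentSpan_le : idempotentSpan 𝒜 ≤ Subalgebra.toSubmodule 𝒜 :=
  Submodule.span_le.2 fun _ hT => hT.1

theorem mem_idempotentSpan_of_isIdempotentElem {T : K →L[ℂ] K} (hT : T ∈ 𝒜)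
    (hi : IsIdempotentElem T) : T ∈ idempotentSpan 𝒜 :=
  Submodule.subset_span ⟨hT, hi⟩

/-- A rank-one operator `u ⊗ φ` with `φ u ≠ 0` is a multiple of an idempotent. -/
theorem smulRight_mem_idempotentSpan_of_apply_ne_zero {φ : K →L[ℂ] ℂ} {u : K}
    (hu : φ.smulRight u ∈ 𝒜) (h : φ u ≠ 0) : φ.smulRight u ∈ idempotentSpan 𝒜 := by
  have hi : IsIdempotentElem ((φ u)⁻¹ • φ.smulRight u) := by
    ext w
    simp only [mul_apply_eq_comp, smul_apply,
      ContinuousLinearMap.smulRight_apply, map_smul, smul_smul]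
    congr 1
    field_simp
  have := (idempotentSpan 𝒜).smul_mem (φ u)
    (mem_idempotentSpan_of_isIdempotentElem (𝒜.smul_mem hu (φ u)⁻¹) hi)
  rwa [smul_smul, mul_inv_cancel₀ h, one_smul] at this

/-- A rank-one operator `u ⊗ φ` of square zero is the difference of `(u + u') ⊗ φ` and `u' ⊗ φ`,
neither of which is nilpotent when `φ u' ≠ 0`. -/
theorem smulRight_mem_idempotentSpan {φ : K →L[ℂ] ℂ} {u u' : K} (hu : φ.smulRight u ∈ 𝒜)
    (hu' : φ.smulRight u' ∈ 𝒜) (h : φ u' ≠ 0) : φ.smulRight u ∈ idempotentSpan 𝒜 := by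
  by_cases h0 : φ u = 0
  · have e : φ.smulRight (u + u') = φ.smulRight u + φ.smulRight u' := by
      ext w; simp
    have h1 : φ.smulRight (u + u') ∈ 𝒜 := e ▸ 𝒜.add_mem hu hu'
    have h2 := smulRight_mem_idempotentSpan_of_apply_ne_zero h1 (by simpa [h0] using h)
    have h3 := smulRight_mem_idempotentSpan_of_apply_ne_zero hu' h
    have := (idempotentSpan 𝒜).sub_mem h2 h3
    rwa [e, add_sub_cancel_right] at this
  · exact smulRight_mem_idempotentSpan_of_apply_ne_zero hu h0

/-- The failure of the Leibniz rule for `δ` at the pair `(a, b)`. -/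
noncomputable def defect (δ : 𝒜 →ₗ[ℂ] (K →L[ℂ] K)) (a b : 𝒜) : K →L[ℂ] K :=
  δ (a * b) - δ a * (b : K →L[ℂ] K) - (a : K →L[ℂ] K) * δ b

theorem defect_add (δ : 𝒜 →ₗ[ℂ] (K →L[ℂ] K)) (a a' b : 𝒜) :
    defect δ (a + a') b = defect δ a b + defect δ a' b := by
  simp only [defect, add_mul, map_add, Subalgebra.coe_add]
  abel

theorem IsLocalDerivation.map_one (h : IsLocalDerivation δ) : δ 1 = 0 := by
  obtain ⟨D, hD, e⟩ := h 1
  have := hD 1 1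
  rw [e]
  simpa using this

/-- The algebraic trace of locality: if `ab = 0 = bc` then `D(b) = δ(b)` gives `a δ(b) c = 0`. -/
theorem IsLocalDerivation.mul_map_mul_eq_zero (h : IsLocalDerivation δ) {a b c : 𝒜}
    (hab : a * b = 0) (hbc : b * c = 0) :
    (a : K →L[ℂ] K) * δ b * (c : K →L[ℂ] K) = 0 := by
  obtain ⟨D, hD, e⟩ := h b
  have h1 := hD a b
  rw [hab, map_zero] at h1
  have h2 : (b : K →L[ℂ] K) * (c : K →L[ℂ] K) = 0 := congrArg Subtype.val hbc
  rw [e, eq_neg_of_add_eq_zero_right h1.symm, neg_mul, mul_assoc, h2, mul_zero, neg_zero]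

/-- Cut `a` into four corners by `p` and `q` and apply `mul_map_mul_eq_zero` to each corner. -/
theorem IsLocalDerivation.map_mul_mul_of_isIdempotentElem (h : IsLocalDerivation δ) {p q : 𝒜}
    (hp : IsIdempotentElem p) (hq : IsIdempotentElem q) (a : 𝒜) :
    δ (p * a * q) = δ (p * a) * (q : K →L[ℂ] K) + (p : K →L[ℂ] K) * δ (a * q)
      - (p : K →L[ℂ] K) * δ a * (q : K →L[ℂ] K) := by
  have hp1 : p * (1 - p) = 0 := by rw [mul_sub, mul_one, hp.eq, sub_self]
  have hp2 : (1 - p) * p = 0 := by rw [sub_mul, one_mul, hp.eq, sub_self]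
  have hq1 : q * (1 - q) = 0 := by rw [mul_sub, mul_one, hq.eq, sub_self]
  have hq2 : (1 - q) * q = 0 := by rw [sub_mul, one_mul, hq.eq, sub_self]
  have e1 := h.mul_map_mul_eq_zero (a := 1 - p) (b := p * a * q) (c := 1 - q)
    (by rw [mul_assoc, ← mul_assoc, hp2, zero_mul]) (by rw [mul_assoc, hq1, mul_zero])
  have e2 := h.mul_map_mul_eq_zero (a := p) (b := (1 - p) * a * q) (c := 1 - q)
    (by rw [mul_assoc, ← mul_assoc, hp1, zero_mul]) (by rw [mul_assoc, hq1, mul_zero])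
  have e3 := h.mul_map_mul_eq_zero (a := 1 - p) (b := p * a * (1 - q)) (c := q)
    (by rw [mul_assoc, ← mul_assoc, hp2, zero_mul]) (by rw [mul_assoc, hq2, mul_zero])
  have e4 := h.mul_map_mul_eq_zero (a := p) (b := (1 - p) * a * (1 - q)) (c := q)
    (by rw [mul_assoc, ← mul_assoc, hp1, zero_mul]) (by rw [mul_assoc, hq2, mul_zero])
  simp only [mul_sub, sub_mul, mul_one, one_mul, map_sub, Subalgebra.coe_sub,
    Subalgebra.coe_one] at e1 e2 e3 e4 ⊢
  have := congrArg₂ (· + ·) (congrArg₂ (· - ·) e1 e2) (congrArg₂ (· - ·) e4 e3)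
  simp only [sub_zero, add_zero] at this
  rw [← sub_eq_zero, ← this]
  abel

theorem IsLocalDerivation.map_mul_mul (h : IsLocalDerivation δ) {p q : 𝒜}
    (hp : (p : K →L[ℂ] K) ∈ idempotentSpan 𝒜) (hq : (q : K →L[ℂ] K) ∈ idempotentSpan 𝒜) (a : 𝒜) :
    δ (p * a * q) = δ (p * a) * (q : K →L[ℂ] K) + (p : K →L[ℂ] K) * δ (a * q)
      - (p : K →L[ℂ] K) * δ a * (q : K →L[ℂ] K) := by
  rw [mem_idempotentSpan_iff] at hp hq
  induction hp using Submodule.span_induction with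
  | mem p hp =>
    induction hq using Submodule.span_induction with
    | mem q hq => exact h.map_mul_mul_of_isIdempotentElem hp hq a
    | zero => simp
    | add x y _ _ hx hy =>
      simp only [mul_add, map_add, Subalgebra.coe_add, hx, hy]; abel
    | smul c x _ hx =>
      simp only [mul_smul_comm, map_smul, Subalgebra.coe_smul, hx, smul_add, smul_sub]
  | zero => simp
  | add x y _ _ hx hy =>
    simp only [add_mul, map_add, Subalgebra.coe_add, hx, hy]; abel
  | smul c x _ hx =>
    simp only [smul_mul_assoc, map_smul, Subalgebra.coe_smul, hx, smul_add, smul_sub]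

/-- Multiplying the defect from the left by a combination `p` of idempotents moves `p` into the
first argument. -/
theorem IsLocalDerivation.mul_defect (h : IsLocalDerivation δ) {p k : 𝒜}
    (hp : (p : K →L[ℂ] K) ∈ idempotentSpan 𝒜) (hk : (k : K →L[ℂ] K) ∈ idempotentSpan 𝒜) (a : 𝒜) :
    (p : K →L[ℂ] K) * defect δ a k = defect δ (p * a) k := by
  simp only [defect, mul_sub, Subalgebra.coe_mul, h.map_mul_mul hp hk a]
  noncomm_ring

theorem IsLocalDerivation.defect_eq_zero (h : IsLocalDerivation δ) {p k : 𝒜}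
    (hp : (p : K →L[ℂ] K) ∈ idempotentSpan 𝒜) (hk : (k : K →L[ℂ] K) ∈ idempotentSpan 𝒜) :
    defect δ p k = 0 := by
  have := h.map_mul_mul hp hk 1
  simp only [mul_one, one_mul, h.map_one, mul_zero, zero_mul, sub_zero] at this
  simp [defect, this]

/-- If the Leibniz rule holds for all pairs `(a, k)` with `k` in a left ideal `J` whose ranges
together are total, then it holds for all pairs. -/
theorem isDerivation_of_defect_eq_zero (J : Set 𝒜) (hJ : ∀ a, ∀ k ∈ J, a * k ∈ J)
    (hdef : ∀ a, ∀ k ∈ J, defect δ a k = 0)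
    (hsep : ∀ M : K →L[ℂ] K, (∀ k ∈ J, M * (k : K →L[ℂ] K) = 0) → M = 0) : IsDerivation δ := by
  have key : ∀ a, ∀ k ∈ J,
      δ (a * k) = δ a * (k : K →L[ℂ] K) + (a : K →L[ℂ] K) * δ k := fun a k hk => by
    have := hdef a k hk
    rw [defect, sub_sub, sub_eq_zero] at this
    exact this
  intro a b
  rw [← sub_eq_zero]
  refine hsep _ fun k hk => ?_
  have h1 := key (a * b) k hk
  have h2 := key a (b * k) (hJ b k hk)
  rw [key b k hk] at h2
  rw [mul_assoc, h2] at h1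
  simp only [Subalgebra.coe_mul] at h1
  rw [sub_mul, sub_eq_zero]
  calc δ (a * b) * (k : K →L[ℂ] K)
      = (δ (a * b) * (k : K →L[ℂ] K) + (a : K →L[ℂ] K) * b * δ k)
        - (a : K →L[ℂ] K) * b * δ k := by abel
    _ = _ := by rw [← h1]; noncomm_ring

/-- If `c k = 0` and `δ(c) = D(c)` with a derivation `D`, then the defect at `(c, k)` factors
through `c`. -/
theorem IsLocalDerivation.exists_defect_eq_mul (h : IsLocalDerivation δ) {c k : 𝒜}
    (hck : c * k = 0) : ∃ R : K →L[ℂ] K, defect δ c k = (c : K →L[ℂ] K) * R := by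
  obtain ⟨D, hD, e⟩ := h c
  refine ⟨D k - δ k, ?_⟩
  have := hD c k
  rw [hck, map_zero] at this
  rw [defect, hck, map_zero, e, mul_sub, zero_sub, eq_neg_of_add_eq_zero_left this.symm]
  abel

/-- If `u ⊗ φ` is a combination of idempotents even after multiplication from the right by `a`,
then `φ` annihilates the range of the defects at `(a, k)`. -/
theorem IsLocalDerivation.apply_defect_eq_zero (h : IsLocalDerivation δ) {a k : 𝒜}
    (hk : (k : K →L[ℂ] K) ∈ idempotentSpan 𝒜) {φ : K →L[ℂ] ℂ}
    {u : K} (hu : u ≠ 0) (h1 : φ.smulRight u ∈ idempotentSpan 𝒜)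
    (h2 : (φ.comp (a : K →L[ℂ] K)).smulRight u ∈ idempotentSpan 𝒜) (w : K) :
    φ (defect δ a k w) = 0 := by
  let p : 𝒜 := ⟨φ.smulRight u, idempotentSpan_le h1⟩
  have e := h.mul_defect (p := p) h1 hk a
  rw [h.defect_eq_zero (p := p * a) h2 hk] at e
  exact (smul_eq_zero.1 (DFunLike.congr_fun e w)).resolve_right hu

end LocalDerivations

/-! ### The condition on immediate predecessors -/

section Predecessor

variable {H : Type*} [NormedAddCommGroup H] [InnerProductSpace ℂ H]
  {L : Set (ClosedSubmodule ℂ H)}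

theorem predecessor_mem (hL : IsSubspaceLattice L) (P : ClosedSubmodule ℂ H) :
    predecessor L P ∈ L :=
  hL.sSup_mem _ fun _ hQ => hQ.1

theorem le_predecessor {P Q : ClosedSubmodule ℂ H} (hQ : Q ∈ L) (h : ¬ P ≤ Q) :
    Q ≤ predecessor L P :=
  le_sSup ⟨hQ, h⟩

/-- The intersection of all `P₋` with `P ≠ 0` is zero: a nonzero `R` that does not contain the
intersection `Q` would satisfy `R ≤ Q₋ = Q ≤ R₋`, hence `R = R₋ ≥ Q`. -/
theorem sInf_predecessor_eq_bot (hL : IsSubspaceLattice L)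
    (hpred : ∀ P ∈ L, P ≠ ⊥ → ¬ P < predecessor L P) :
    sInf {R | ∃ P ∈ L, P ≠ ⊥ ∧ R = predecessor L P} = ⊥ := by
  set Q := sInf {R | ∃ P ∈ L, P ≠ ⊥ ∧ R = predecessor L P} with hQdef
  have hQL : Q ∈ L := hL.sInf_mem _ (by rintro _ ⟨P, -, -, rfl⟩; exact predecessor_mem hL P)
  have hQle : ∀ P ∈ L, P ≠ ⊥ → Q ≤ predecessor L P := fun P hP h0 => sInf_le ⟨P, hP, h0, rfl⟩
  have hself : ∀ P ∈ L, P ≠ ⊥ → P ≤ predecessor L P → P = predecessor L P := fun P hP h0 hle =>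
    hle.eq_of_not_lt (hpred P hP h0)
  by_contra hQ
  have hQQ := hself Q hQL hQ (hQle Q hQL hQ)
  have hall : predecessor L Q ≤ ⊥ := by
    refine sSup_le ?_
    rintro R ⟨hR, hQR⟩
    by_contra hR0
    rw [le_bot_iff] at hR0
    have h1 : R ≤ Q := (le_predecessor hR hQR).trans hQQ.ge
    have h2 := hself R hR hR0 (h1.trans (hQle R hR hR0))
    exact hQR (h2 ▸ hQle R hR hR0)
  exact hQ (le_bot_iff.1 (hQQ.le.trans hall))

/-- The members `P` with `P₋ ≠ H` span a dense subspace: otherwise, by the hypothesis, every proper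
member would lie in their span, so that `H₋ ≠ H` and `H` itself would be one of them. -/
theorem sSup_predecessor_ne_top_eq_top (hL : IsSubspaceLattice L)
    (hpred : ∀ P ∈ L, P ≠ ⊥ → ¬ P < predecessor L P) :
    sSup {P | P ∈ L ∧ predecessor L P ≠ ⊤} = ⊤ := by
  set Q := sSup {P | P ∈ L ∧ predecessor L P ≠ ⊤} with hQdef
  by_contra hQ
  have hle : ∀ P ∈ L, P ≠ ⊤ → P ≤ Q := by
    intro P hP hPt
    by_contra hPQ
    have h1 : predecessor L P = ⊤ := by
      by_contra h
      exact hPQ (le_sSup ⟨hP, h⟩)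
    refine hpred P hP (fun h => hPQ (h ▸ bot_le)) ?_
    rw [h1]
    exact lt_top_iff_ne_top.2 hPt
  have h2 : predecessor L ⊤ ≤ Q := sSup_le fun R hR => hle R hR.1 fun h => hR.2 h.ge
  have h3 : (⊤ : ClosedSubmodule ℂ H) ≤ Q :=
    le_sSup ⟨hL.top_mem, fun h => hQ (top_le_iff.1 (h ▸ h2))⟩
  exact hQ (top_le_iff.1 h3)

/-- `x ⊗ ψ` belongs to `Alg L` if `x ∈ P` and `ψ` vanishes on `P₋`. -/
theorem smulRight_mem_Alg {P : ClosedSubmodule ℂ H} {x : H} (hx : x ∈ P)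
    {ψ : H →L[ℂ] ℂ} (hψ : ∀ y ∈ predecessor L P, ψ y = 0) : ψ.smulRight x ∈ Alg L := by
  intro E hE y hy
  by_cases h : P ≤ E
  · exact E.toSubmodule.smul_mem _ (h hx)
  · rw [ContinuousLinearMap.smulRight_apply, hψ y (le_predecessor hE h hy), zero_smul]
    exact E.toSubmodule.zero_mem

theorem smulRight_mem_idempotentSpan_of_rankOneSpan_le {𝒜 : Subalgebra ℂ (H →L[ℂ] H)}
    (hrank : rankOneSpan 𝒜 ≤ idempotentSpan 𝒜) {ψ : H →L[ℂ] ℂ} {x : H}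
    (h : ψ.smulRight x ∈ 𝒜) : ψ.smulRight x ∈ idempotentSpan 𝒜 := by
  by_cases hx : x = 0
  · have : ψ.smulRight x = 0 := by ext; simp [hx]
    rw [this]
    exact Submodule.zero_mem _
  by_cases hψ : ψ = 0
  · have : ψ.smulRight x = 0 := by ext; simp [hψ]
    rw [this]
    exact Submodule.zero_mem _
  refine hrank (Submodule.subset_span ⟨h, ?_⟩)
  obtain ⟨y, hy⟩ : ∃ y, ψ y ≠ 0 := by
    by_contra! h0
    exact hψ (ContinuousLinearMap.ext h0)
  have : LinearMap.range (ψ.smulRight x : H →ₗ[ℂ] H) = ℂ ∙ x := by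
    ext z
    simp only [LinearMap.mem_range, Submodule.mem_span_singleton]
    constructor
    · rintro ⟨w, rfl⟩
      exact ⟨ψ w, rfl⟩
    · rintro ⟨c, rfl⟩
      exact ⟨(c / ψ y) • y, by simp [smul_smul, hy]⟩
  rw [this]
  exact finrank_span_singleton hx

/-- Operators of rank at most one are combinations of idempotents in the algebra of all
operators. -/
theorem smulRight_mem_idempotentSpan_top [CompleteSpace H] (ψ : H →L[ℂ] ℂ) (x : H) :
    ψ.smulRight x ∈ idempotentSpan (⊤ : Subalgebra ℂ (H →L[ℂ] H)) := by
  by_cases h : ∃ y, ψ y ≠ 0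
  · obtain ⟨y, hy⟩ := h
    exact smulRight_mem_idempotentSpan (u' := y) Algebra.mem_top Algebra.mem_top hy
  · push Not at h
    have : ψ.smulRight x = 0 := by ext; simp [h]
    rw [this]
    exact Submodule.zero_mem _

/-- A vector outside a closed subspace is separated from it by a functional vanishing there. -/
theorem exists_functional_ne_zero [CompleteSpace H] {P : ClosedSubmodule ℂ H} {x : H}
    (hx : x ∉ P) : ∃ ψ : H →L[ℂ] ℂ, (∀ y ∈ P, ψ y = 0) ∧ ψ x ≠ 0 := by
  by_contra! h
  apply hx
  have h1 : x ∈ P.toSubmoduleᗮᗮ := by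
    rw [Submodule.mem_orthogonal]
    intro u hu
    exact h (innerSL ℂ u) fun y hy => Submodule.mem_orthogonal' _ _ |>.1 hu y hy
  rw [Submodule.orthogonal_orthogonal_eq_closure] at h1
  have h2 : P.toSubmodule.topologicalClosure = P.toSubmodule :=
    IsClosed.submodule_topologicalClosure_eq P.isClosed
  rwa [h2] at h1

end Predecessor

/-! ### Operators on direct sums of copies -/

section Copies

variable {ι : Type*} {H : Type*} [NormedAddCommGroup H] [InnerProductSpace ℂ H]

/-- The projection onto the `i`-th coordinate. -/
noncomputable def coord (i : ι) : Copies ι H →L[ℂ] H :=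
  lp.evalCLM ℂ (fun _ : ι => H) 2 i

@[simp]
theorem coord_apply (i : ι) (v : Copies ι H) : coord i v = v i := rfl

theorem norm_ofReal_smul_apply {c : ℝ} (hc : 0 ≤ c) (v : Copies ι H) (i : ι) :
    ‖((c : ℂ) • v) i‖ = c * ‖v i‖ := by
  rw [lp.coeFn_smul, Pi.smul_apply, norm_smul, Complex.norm_real, Real.norm_of_nonneg hc]

/-- The map `x ↦ (ζ i • x)_i`. -/
noncomputable def diagEmb (ζ : Copies ι ℂ) : H →L[ℂ] Copies ι H :=
  LinearMap.mkContinuous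
    { toFun := fun x => ⟨fun i => ζ i • x,
        (lp.memℓp ((‖x‖ : ℂ) • ζ)).mono' fun i => by
          simp only [norm_ofReal_smul_apply (norm_nonneg _), norm_smul, mul_comm, le_refl]⟩
      map_add' := fun x y => by ext i; exact smul_add _ _ _
      map_smul' := fun c x => by ext i; exact smul_comm _ _ _ }
    ‖ζ‖ fun x => by
      refine (lp.norm_mono (y := (‖x‖ : ℂ) • ζ) two_ne_zero
        fun i => by
          rw [norm_ofReal_smul_apply (norm_nonneg _), mul_comm]
          exact (norm_smul _ _).le).trans ?_
      rw [norm_smul, Complex.norm_real, norm_norm, mul_comm]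

@[simp]
theorem diagEmb_apply (ζ : Copies ι ℂ) (x : H) (i : ι) : diagEmb ζ x i = ζ i • x := rfl

/-- The diagonal operator `I ⊗ T`, acting as `T` in every coordinate. -/
noncomputable def mapCopies (T : H →L[ℂ] H) : Copies ι H →L[ℂ] Copies ι H :=
  LinearMap.mkContinuous
    { toFun := fun v => ⟨fun i => T (v i),
        (lp.memℓp ((‖T‖ : ℂ) • v)).mono' fun i => by
          simpa only [norm_ofReal_smul_apply (norm_nonneg _)] using T.le_opNorm (v i)⟩
      map_add' := fun x y => by ext i; exact map_add T _ _
      map_smul' := fun c x => by ext i; exact map_smul T _ _ }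
    ‖T‖ fun v => by
      refine (lp.norm_mono (y := (‖T‖ : ℂ) • v) two_ne_zero
        fun i => by
          rw [norm_ofReal_smul_apply (norm_nonneg _)]
          exact T.le_opNorm (v i)).trans ?_
      rw [norm_smul, Complex.norm_real, norm_norm]

theorem mem_diagonal_iff {ζ : Copies ι ℂ} {i₀ : ι} (h0 : ζ i₀ ≠ 0) {v : Copies ι H} :
    v ∈ diagonal (fun i => ζ i) ↔ ∀ j, ζ i₀ • v j = ζ j • v i₀ := by
  constructor
  · intro hv j
    let E : ClosedSubmodule ℂ (Copies ι H) :=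
      (⊥ : ClosedSubmodule ℂ H).comap (ζ i₀ • coord j - ζ j • coord i₀)
    have hle : diagonal (fun i => ζ i) ≤ E := by
      refine Submodule.closure_le.2 (Submodule.span_le.2 ?_)
      rintro w ⟨x, hx⟩
      change ζ i₀ • w j - ζ j • w i₀ = 0
      rw [hx, hx, smul_comm, sub_self]
    exact sub_eq_zero.1 (hle hv)
  · intro h
    refine subset_closure (Submodule.subset_span ⟨(ζ i₀)⁻¹ • v i₀, fun i => ?_⟩)
    rw [smul_comm, ← h i, smul_smul, inv_mul_cancel₀ h0, one_smul]

theorem diagEmb_mem_diagonal (ζ : Copies ι ℂ) (x : H) : diagEmb ζ x ∈ diagonal (fun i => ζ i) :=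
  subset_closure (Submodule.subset_span ⟨x, fun _ => rfl⟩)

theorem eq_diagEmb_of_mem_diagonal {ζ : Copies ι ℂ} {i₀ : ι} (h0 : ζ i₀ ≠ 0) {v : Copies ι H}
    (hv : v ∈ diagonal (fun i => ζ i)) : v = diagEmb ζ ((ζ i₀)⁻¹ • v i₀) := by
  ext i
  rw [diagEmb_apply, smul_comm, ← (mem_diagonal_iff h0).1 hv i, smul_smul, inv_mul_cancel₀ h0,
    one_smul]

theorem eq_zero_of_mem_diagonal {ζ : Copies ι ℂ} (hζ : ∀ i, ζ i ≠ 0) {v : Copies ι H}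
    (hv : v ∈ diagonal (fun i => ζ i)) {i : ι} (hi : v i = 0) : v = 0 := by
  rw [eq_diagEmb_of_mem_diagonal (hζ i) hv, hi, smul_zero, map_zero]

/-- The map `v ↦ (ζ j)⁻¹ v_j - (ζ l)⁻¹ v_l`, which annihilates the diagonal. -/
noncomputable def quotSub (ζ : Copies ι ℂ) (j l : ι) : Copies ι H →L[ℂ] H :=
  (ζ j)⁻¹ • coord j - (ζ l)⁻¹ • coord l

theorem quotSub_apply (ζ : Copies ι ℂ) (j l : ι) (v : Copies ι H) :
    quotSub ζ j l v = (ζ j)⁻¹ • v j - (ζ l)⁻¹ • v l := rfl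

theorem quotSub_eq_zero_of_mem_diagonal {ζ : Copies ι ℂ} (hζ : ∀ i, ζ i ≠ 0) (j l : ι)
    {v : Copies ι H}
    (hv : v ∈ diagonal (fun i => ζ i)) : quotSub ζ j l v = 0 := by
  rw [eq_diagEmb_of_mem_diagonal (hζ j) hv, quotSub_apply, diagEmb_apply, diagEmb_apply,
    inv_smul_smul₀ (hζ j), inv_smul_smul₀ (hζ l), sub_self]

variable [LinearOrder ι]

/-- The inclusion of `H` as the `i`-th summand. -/
noncomputable def incl (i : ι) : H →L[ℂ] Copies ι H :=
  lp.singleContinuousLinearMap ℂ (fun _ : ι => H) 2 i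

theorem incl_apply (i : ι) (x : H) (j : ι) : incl i x j = if j = i then x else 0 := by
  change lp.single (E := fun _ : ι => H) 2 i x j = _
  split_ifs with h
  · subst h; exact lp.single_apply_self _ _ _
  · exact lp.single_apply_ne _ _ _ h

@[simp]
theorem incl_apply_self (i : ι) (x : H) : incl i x i = x := by simp [incl_apply]

theorem incl_apply_ne {i j : ι} (h : j ≠ i) (x : H) : incl i x j = 0 := by simp [incl_apply, h]

theorem hasSum_incl (v : Copies ι H) : HasSum (fun i => incl i (v i)) v :=
  lp.hasSum_single (by simp) v

theorem eq_zero_of_forall_incl {F : Type*} [NormedAddCommGroup F] [NormedSpace ℂ F]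
    {M : Copies ι H →L[ℂ] F} (h : ∀ i x, M (incl i x) = 0) : M = 0 := by
  ext v
  have := (hasSum_incl v).mapL M
  simp only [h] at this
  exact this.unique hasSum_zero

theorem incl_mem_initialSum {i k : ι} (h : i ≤ k) (x : H) : incl i x ∈ initialSum k :=
  fun _ hj => incl_apply_ne (h.trans_lt hj).ne' x

theorem initialSum_mono {k l : ι} (h : k ≤ l) {v : Copies ι H} (hv : v ∈ initialSum k) :
    v ∈ initialSum l :=
  fun j hj => hv j (h.trans_lt hj)

theorem eq_sum_incl_of_mem_initialSum [LocallyFiniteOrderBot ι] {k : ι} {v : Copies ι H}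
    (hv : v ∈ initialSum k) : v = ∑ i ∈ Finset.Iic k, incl i (v i) := by
  refine (hasSum_incl v).unique (hasSum_sum_of_ne_finset_zero fun j hj => ?_)
  rw [hv j (by simpa using hj), map_zero]

end Copies

/-! ### The algebra of the lattice on the direct sum -/

section AlgCopies

variable {K : Type*} [NormedAddCommGroup K] [InnerProductSpace ℂ K]

/-- The closed subspaces invariant under one operator form a subspace lattice. -/
theorem isSubspaceLattice_invariant (a : K →L[ℂ] K) :
    IsSubspaceLattice {E : ClosedSubmodule ℂ K | ∀ x ∈ E, a x ∈ E} where
  bot_mem := fun x hx => by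
    rw [ClosedSubmodule.mem_bot] at hx ⊢
    rw [hx, map_zero]
  top_mem := fun _ _ => ClosedSubmodule.mem_top
  sSup_mem := fun S hS x hx => by
    have : sSup S ≤ (sSup S).comap a := sSup_le fun E hE y hy => le_sSup hE (hS hE y hy)
    exact this hx
  sInf_mem := fun S hS x hx => by
    rw [ClosedSubmodule.mem_sInf] at hx ⊢
    exact fun E hE => hS hE x (hx E hE)

theorem mem_Alg_generatedLattice_iff {G : Set (ClosedSubmodule ℂ K)} {a : K →L[ℂ] K} :
    a ∈ Alg (generatedLattice G) ↔ ∀ E ∈ G, ∀ x ∈ E, a x ∈ E := by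
  constructor
  · intro h E hE
    exact h E fun L hL => hL.2 hE
  · intro h E hE
    exact hE _ ⟨isSubspaceLattice_invariant a, h⟩

variable {ι : Type*} [LinearOrder ι] {H : Type*} [NormedAddCommGroup H] [InnerProductSpace ℂ H]
  {L₀ : Set (ClosedSubmodule ℂ H)} {i₀ : ι} {ζ : Copies ι ℂ}

theorem firstCopy_le_initialSum (i₀ : ι) (P : ClosedSubmodule ℂ H) :
    firstCopy i₀ P ≤ initialSum i₀ :=
  fun _ hv j hj => hv.2 j hj.ne'

theorem incl_mem_firstCopy {P : ClosedSubmodule ℂ H} {x : H} (hx : x ∈ P) :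
    incl i₀ x ∈ firstCopy i₀ P :=
  ⟨by rwa [incl_apply_self], fun _ hj => incl_apply_ne hj x⟩

theorem mem_Alg_copiesLattice_iff (hi₀ : ∀ j, i₀ ≤ j) (htop : ⊤ ∈ L₀)
    {a : Copies ι H →L[ℂ] Copies ι H} :
    a ∈ Alg (copiesLattice i₀ (fun i => ζ i) L₀) ↔
      (∀ P ∈ L₀, ∀ v ∈ firstCopy i₀ P, a v ∈ firstCopy i₀ P) ∧
      (∀ v ∈ diagonal (fun i => ζ i), a v ∈ diagonal (fun i => ζ i)) ∧
      ∀ k, ∀ v ∈ initialSum k, a v ∈ initialSum k := by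
  rw [copiesLattice, mem_Alg_generatedLattice_iff]
  constructor
  · intro h
    have h1 : ∀ P ∈ L₀, ∀ v ∈ firstCopy i₀ P, a v ∈ firstCopy i₀ P :=
      fun P hP => h _ (Or.inl (Or.inl ⟨P, hP, rfl⟩))
    refine ⟨h1, h _ (Or.inl (Or.inr rfl)), fun k v hv => ?_⟩
    rcases (hi₀ k).eq_or_lt with rfl | hk
    · -- The first summand is the copy of the whole space `⊤ ∈ L₀`.
      exact firstCopy_le_initialSum _ _ (h1 ⊤ htop v
        ⟨ClosedSubmodule.mem_top, fun j hj => hv j (lt_of_le_of_ne (hi₀ j) hj.symm)⟩)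
    · exact h _ (Or.inr ⟨k, hk, rfl⟩) v hv
  · rintro ⟨h1, h2, h3⟩ E ((⟨P, hP, rfl⟩ | rfl) | ⟨k, -, rfl⟩)
    · exact h1 P hP
    · exact h2
    · exact h3 k

/-- The functional `φ` vanishes on the diagonal, on the first summand, and on `F_k` for `k < l`;
then all `u ⊗ φ` with `u ∈ F_l` belong to the algebra. -/
structure KillsBelow (i₀ : ι) (ζ : Copies ι ℂ) (l : ι) (φ : Copies ι H →L[ℂ] ℂ) : Prop where
  diag : ∀ v ∈ diagonal (fun i => ζ i), φ v = 0
  first : ∀ v ∈ initialSum i₀, φ v = 0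
  below : ∀ k < l, ∀ v ∈ initialSum k, φ v = 0

theorem KillsBelow.smulRight_mem_Alg (hi₀ : ∀ j, i₀ ≤ j) (htop : ⊤ ∈ L₀) {l : ι}
    {φ : Copies ι H →L[ℂ] ℂ} (hφ : KillsBelow i₀ ζ l φ) {u : Copies ι H}
    (hu : u ∈ initialSum l) :
    φ.smulRight u ∈ Alg (copiesLattice i₀ (fun i => ζ i) L₀) := by
  refine (mem_Alg_copiesLattice_iff hi₀ htop).2
    ⟨fun P _ v hv => ?_, fun v hv => ?_, fun k v hv => ?_⟩
  · rw [ContinuousLinearMap.smulRight_apply, hφ.first v (firstCopy_le_initialSum i₀ P hv),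
      zero_smul]
    exact (firstCopy i₀ P).toSubmodule.zero_mem
  · rw [ContinuousLinearMap.smulRight_apply, hφ.diag v hv, zero_smul]
    exact (diagonal fun i => ζ i).toSubmodule.zero_mem
  · rw [ContinuousLinearMap.smulRight_apply]
    rcases lt_or_ge k l with hk | hk
    · rw [hφ.below k hk v hv, zero_smul]
      exact (initialSum k).toSubmodule.zero_mem
    · exact (initialSum k).toSubmodule.smul_mem _ (initialSum_mono hk hu)

theorem KillsBelow.comp (hi₀ : ∀ j, i₀ ≤ j) (htop : ⊤ ∈ L₀) {l : ι}
    {φ : Copies ι H →L[ℂ] ℂ} (hφ : KillsBelow i₀ ζ l φ) {a : Copies ι H →L[ℂ] Copies ι H}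
    (ha : a ∈ Alg (copiesLattice i₀ (fun i => ζ i) L₀)) : KillsBelow i₀ ζ l (φ.comp a) := by
  obtain ⟨-, h2, h3⟩ := (mem_Alg_copiesLattice_iff hi₀ htop).1 ha
  exact ⟨fun v hv => hφ.diag _ (h2 v hv), fun v hv => hφ.first _ (h3 _ v hv),
    fun k hk v hv => hφ.below k hk _ (h3 k v hv)⟩

/-- With `l'` the first coordinate on which `φ` does not vanish, `φ` still vanishes on `F_k` for
`k < l'`, and a vector of the `l'`-th summand serves as `u'` in `smulRight_mem_idempotentSpan`. -/
theorem KillsBelow.smulRight_mem_idempotentSpan [LocallyFiniteOrderBot ι] (hi₀ : ∀ j, i₀ ≤ j)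
    (htop : ⊤ ∈ L₀) {l : ι} {φ : Copies ι H →L[ℂ] ℂ} (hφ : KillsBelow i₀ ζ l φ)
    {u : Copies ι H} (hu : u ∈ initialSum l) :
    φ.smulRight u ∈ idempotentSpan (Alg (copiesLattice i₀ (fun i => ζ i) L₀)) := by
  by_cases h0 : φ = 0
  · have : φ.smulRight u = 0 := by ext; simp [h0]
    rw [this]
    exact Submodule.zero_mem _
  obtain ⟨l', ⟨z, hz⟩, hmin⟩ : ∃ l', (∃ z, φ (incl l' z) ≠ 0) ∧
      ∀ j < l', ∀ z, φ (incl j z) = 0 := by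
    obtain ⟨m, hm⟩ : ∃ m, ∃ z, φ (incl m z) ≠ 0 := by
      by_contra! h
      exact h0 (eq_zero_of_forall_incl h)
    obtain ⟨l', hl', hmin⟩ := ((Set.finite_Iic m).inter_of_left
      {j | ∃ z, φ (incl j z) ≠ 0}).exists_minimal ⟨m, le_rfl, hm⟩
    refine ⟨l', hl'.2, fun j hj z => ?_⟩
    by_contra hz
    exact hj.not_ge (hmin ⟨hj.le.trans hl'.1, z, hz⟩ hj.le)
  have hφ' : KillsBelow i₀ ζ l' φ := ⟨hφ.diag, hφ.first, fun k hk v hv => by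
    rw [eq_sum_incl_of_mem_initialSum hv, map_sum]
    exact Finset.sum_eq_zero fun i hi => hmin i ((Finset.mem_Iic.1 hi).trans_lt hk) _⟩
  exact LocalDer.smulRight_mem_idempotentSpan (hφ.smulRight_mem_Alg hi₀ htop hu)
    (hφ'.smulRight_mem_Alg hi₀ htop (incl_mem_initialSum le_rfl z)) hz

/-- When there is a last index `N`, the algebra also contains the operators `u ⊗ φ` with `u` in
the diagonal and `φ` supported in the last summand. -/
theorem smulRight_mem_idempotentSpan_of_last (hi₀ : ∀ j, i₀ ≤ j) (htop : ⊤ ∈ L₀) {N : ι}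
    (hN : i₀ < N) (hζN : ζ N ≠ 0) (ψ : H →L[ℂ] ℂ) {u : Copies ι H}
    (hlast : ∀ j, j ≤ N) (hu : u ∈ diagonal (fun i => ζ i)) :
    (ψ.comp (coord N)).smulRight u ∈
      idempotentSpan (Alg (copiesLattice i₀ (fun i => ζ i) L₀)) := by
  have hmem : ∀ w ∈ diagonal (fun i => ζ i), (ψ.comp (coord N)).smulRight w ∈
      Alg (copiesLattice i₀ (fun i => ζ i) L₀) := by
    intro w hw
    refine (mem_Alg_copiesLattice_iff hi₀ htop).2
      ⟨fun P _ v hv => ?_, fun v hv => ?_, fun k v hv => ?_⟩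
    · have : (ψ.comp (coord N)).smulRight w v = 0 := by simp [hv.2 N hN.ne']
      rw [this]
      exact (firstCopy i₀ P).toSubmodule.zero_mem
    · exact (diagonal fun i => ζ i).toSubmodule.smul_mem _ hw
    · rcases (hlast k).eq_or_lt with rfl | hk
      · exact fun j hj => absurd hj (hlast j).not_gt
      · have : (ψ.comp (coord N)).smulRight w v = 0 := by simp [hv N hk]
        rw [this]
        exact (initialSum k).toSubmodule.zero_mem
  by_cases h0 : ∃ z, ψ z ≠ 0
  · obtain ⟨z, hz⟩ := h0
    refine smulRight_mem_idempotentSpan (hmem u hu) (hmem _ (diagEmb_mem_diagonal ζ z)) ?_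
    simpa using ⟨hζN, hz⟩
  · push Not at h0
    have : (ψ.comp (coord N)).smulRight u = 0 := by ext1 v; simp [h0]
    rw [this]
    exact Submodule.zero_mem _

/-- The operator with first row `(e, -(ζ i₀ / ζ i₁) e, 0, …)` and all other rows zero: the lift of
an operator `e` on `H` to the direct sum that annihilates the diagonal. -/
noncomputable def cornerLift (i₀ i₁ : ι) (ζ : Copies ι ℂ) :
    (H →L[ℂ] H) →ₗ[ℂ] (Copies ι H →L[ℂ] Copies ι H) where
  toFun e := (incl i₀).comp (e.comp (coord i₀ - (ζ i₀ / ζ i₁) • coord i₁))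
  map_add' e f := by ext1 v; exact map_add (incl i₀) _ _
  map_smul' c e := by ext1 v; exact map_smul (incl i₀) _ _

theorem cornerLift_apply (i₀ i₁ : ι) (ζ : Copies ι ℂ) (e : H →L[ℂ] H) (v : Copies ι H) :
    cornerLift i₀ i₁ ζ e v = incl i₀ (e (v i₀ - (ζ i₀ / ζ i₁) • v i₁)) := rfl

theorem cornerLift_mem_idempotentSpan (hi₀ : ∀ j, i₀ ≤ j) (htop : ⊤ ∈ L₀) {i₁ : ι}
    (hi₁ : i₁ ≠ i₀) (hζ : ∀ i, ζ i ≠ 0) {e : H →L[ℂ] H} (he : e ∈ idempotentSpan (Alg L₀)) :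
    cornerLift i₀ i₁ ζ e ∈ idempotentSpan (Alg (copiesLattice i₀ (fun i => ζ i) L₀)) := by
  induction he using Submodule.span_induction with
  | mem e he =>
    obtain ⟨he, hi⟩ := he
    have hee : ∀ x, e (e x) = e x := fun x => DFunLike.congr_fun hi.eq x
    refine mem_idempotentSpan_of_isIdempotentElem ?_ ?_
    · refine (mem_Alg_copiesLattice_iff hi₀ htop).2
        ⟨fun P hP v hv => ?_, fun v hv => ?_, fun k v hv => ?_⟩
      · rw [cornerLift_apply, hv.2 i₁ hi₁, smul_zero, sub_zero]
        exact incl_mem_firstCopy (he P hP _ hv.1)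
      · have h1 := (mem_diagonal_iff (hζ i₀)).1 hv i₁
        have h2 : v i₀ - (ζ i₀ / ζ i₁) • v i₁ = 0 := by
          rw [div_eq_inv_mul, mul_smul, h1, smul_smul, inv_mul_cancel₀ (hζ i₁), one_smul, sub_self]
        rw [cornerLift_apply, h2, map_zero, map_zero]
        exact (diagonal fun i => ζ i).toSubmodule.zero_mem
      · rw [cornerLift_apply]
        exact incl_mem_initialSum (hi₀ k) _
    · ext1 v
      simp only [mul_apply_eq_comp, cornerLift_apply, incl_apply_self,
        incl_apply_ne hi₁, smul_zero, sub_zero, hee]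
  | zero => simp
  | add x y _ _ hx hy => rw [map_add]; exact Submodule.add_mem _ hx hy
  | smul c x _ hx => rw [map_smul]; exact Submodule.smul_mem _ c hx

/-- The operators `u ⊗ φ` with `u = (x, 0, 0, …)`, where `φ` annihilates the diagonal. Up to the
lift of `x ⊗ φ₁ ∈ Alg L₀`, a combination of idempotents by hypothesis, `φ` may be assumed to vanish
on the first summand. -/
theorem smulRight_incl_mem_idempotentSpan [LocallyFiniteOrderBot ι] (hi₀ : ∀ j, i₀ ≤ j)
    (htop : ⊤ ∈ L₀) {i₁ : ι} (hi₁ : i₁ ≠ i₀) (hζ : ∀ i, ζ i ≠ 0)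
    (hrank : rankOneSpan (Alg L₀) ≤ idempotentSpan (Alg L₀)) {P : ClosedSubmodule ℂ H}
    {x : H} (hx : x ∈ P) {φ : Copies ι H →L[ℂ] ℂ}
    (hdiag : ∀ v ∈ diagonal (fun i => ζ i), φ v = 0)
    (hpre : ∀ y ∈ predecessor L₀ P, φ (incl i₀ y) = 0) :
    φ.smulRight (incl i₀ x) ∈ idempotentSpan (Alg (copiesLattice i₀ (fun i => ζ i) L₀)) := by
  set φ₁ : H →L[ℂ] ℂ := φ.comp (incl i₀) with hφ₁
  have h1 := cornerLift_mem_idempotentSpan hi₀ htop hi₁ hζ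
    (smulRight_mem_idempotentSpan_of_rankOneSpan_le hrank
      (smulRight_mem_Alg (L := L₀) hx (ψ := φ₁) hpre))
  set φ' : Copies ι H →L[ℂ] ℂ := φ - φ₁.comp (coord i₀ - (ζ i₀ / ζ i₁) • coord i₁) with hφ'
  have hk : KillsBelow i₀ ζ i₀ φ' := by
    refine ⟨fun v hv => ?_, fun v hv => ?_, fun k hk => absurd hk (hi₀ k).not_gt⟩
    · have h1 := (mem_diagonal_iff (hζ i₀)).1 hv i₁
      have h2 : v i₀ - (ζ i₀ / ζ i₁) • v i₁ = 0 := by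
        rw [div_eq_inv_mul, mul_smul, h1, smul_smul, inv_mul_cancel₀ (hζ i₁), one_smul, sub_self]
      have h3 : φ' v = φ v - φ₁ (v i₀ - (ζ i₀ / ζ i₁) • v i₁) := rfl
      rw [h3, h2, hdiag v hv, map_zero, sub_zero]
    · have h3 : φ' v = φ v - φ (incl i₀ (v i₀ - (ζ i₀ / ζ i₁) • v i₁)) := rfl
      have h4 := eq_sum_incl_of_mem_initialSum hv
      have h5 : Finset.Iic i₀ = {i₀} := by
        ext j
        simpa using ⟨fun h => le_antisymm h (hi₀ j), fun h => h.le⟩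
      rw [h5, Finset.sum_singleton] at h4
      rw [h3, hv i₁ (lt_of_le_of_ne (hi₀ i₁) hi₁.symm), smul_zero, sub_zero, ← h4, sub_self]
  have h2 := hk.smulRight_mem_idempotentSpan (L₀ := L₀) hi₀ htop
    (incl_mem_initialSum le_rfl x)
  have e : φ.smulRight (incl i₀ x) =
      φ'.smulRight (incl i₀ x) + cornerLift i₀ i₁ ζ (φ₁.smulRight x) := by
    ext1 v
    simp only [hφ', add_apply, ContinuousLinearMap.smulRight_apply,
      cornerLift_apply, map_smul, sub_apply, sub_smul]
    exact (sub_add_cancel _ _).symm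
  rw [e]
  exact Submodule.add_mem _ h2 h1

end AlgCopies

/-! ### Defects of local derivations on the algebra -/

section Defects

variable {ι : Type*} [LinearOrder ι] {H : Type*} [NormedAddCommGroup H] [InnerProductSpace ℂ H]
  {L₀ : Set (ClosedSubmodule ℂ H)} {i₀ i₁ : ι} {ζ : Copies ι ℂ}

theorem quotSub_incl {j l : ι} (h : l ≠ j) (x : H) :
    quotSub ζ j l (incl j x) = (ζ j)⁻¹ • x := by
  rw [quotSub_apply, incl_apply_self, incl_apply_ne h, smul_zero, sub_zero]

theorem killsBelow_comp_quotSub (hζ : ∀ i, ζ i ≠ 0) {j l : ι} (hj : i₀ < j) (hjl : j < l)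
    (ψ : H →L[ℂ] ℂ) : KillsBelow i₀ ζ j (ψ.comp (quotSub ζ j l)) := by
  have h : ∀ k < j, ∀ v ∈ initialSum k, ψ.comp (quotSub ζ j l) v = 0 := by
    intro k hk v hv
    rw [ContinuousLinearMap.comp_apply, quotSub_apply, hv j hk, hv l (hk.trans hjl)]
    simp
  refine ⟨fun v hv => ?_, h i₀ hj, h⟩
  rw [ContinuousLinearMap.comp_apply, quotSub_eq_zero_of_mem_diagonal hζ j l hv, map_zero]

/-- The functionals of the rank-one operators in the algebra separate the points outside the
diagonal. -/
theorem mem_diagonal_of_forall_functional [CompleteSpace H] (hi₀ : ∀ j, i₀ ≤ j) (hi₁ : i₁ ≠ i₀)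
    (hζ : ∀ i, ζ i ≠ 0) (hL₀ : IsSubspaceLattice L₀)
    (hpred : ∀ P ∈ L₀, P ≠ ⊥ → ¬ P < predecessor L₀ P) {w : Copies ι H}
    (h1 : ∀ l φ, KillsBelow i₀ ζ l φ → φ w = 0)
    (h2 : ∀ P ∈ L₀, P ≠ ⊥ → ∀ φ : Copies ι H →L[ℂ] ℂ, (∀ v ∈ diagonal (fun i => ζ i), φ v = 0) →
      (∀ y ∈ predecessor L₀ P, φ (incl i₀ y) = 0) → φ w = 0) :
    w ∈ diagonal (fun i => ζ i) := by
  have hlt : ∀ j l, i₀ < j → j < l → (ζ j)⁻¹ • w j = (ζ l)⁻¹ • w l := by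
    intro j l hj hjl
    refine sub_eq_zero.1 (SeparatingDual.eq_zero_of_forall_dual_eq_zero (R := ℂ) fun ψ => ?_)
    exact h1 j _ (killsBelow_comp_quotSub hζ hj hjl ψ)
  have h₀₁ : quotSub ζ i₀ i₁ w = 0 := by
    have : quotSub ζ i₀ i₁ w ∈ sInf {R | ∃ P ∈ L₀, P ≠ ⊥ ∧ R = predecessor L₀ P} := by
      rw [ClosedSubmodule.mem_sInf]
      rintro _ ⟨P, hP, hP0, rfl⟩
      by_contra hw
      obtain ⟨ψ, hψ, hne⟩ := exists_functional_ne_zero hw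
      refine hne (h2 P hP hP0 (ψ.comp (quotSub ζ i₀ i₁)) (fun v hv => ?_) fun y hy => ?_)
      · rw [ContinuousLinearMap.comp_apply, quotSub_eq_zero_of_mem_diagonal hζ i₀ i₁ hv, map_zero]
      · rw [ContinuousLinearMap.comp_apply, quotSub_incl hi₁, map_smul, hψ y hy, smul_zero]
    rwa [sInf_predecessor_eq_bot hL₀ hpred] at this
  have h₁ : i₀ < i₁ := lt_of_le_of_ne (hi₀ i₁) hi₁.symm
  rw [mem_diagonal_iff (hζ i₁)]
  intro j
  have key : (ζ j)⁻¹ • w j = (ζ i₁)⁻¹ • w i₁ := by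
    rcases (hi₀ j).eq_or_lt with rfl | hj
    · exact sub_eq_zero.1 h₀₁
    rcases lt_trichotomy j i₁ with h | rfl | h
    · exact hlt j i₁ hj h
    · rfl
    · exact (hlt i₁ j h₁ h).symm
  rw [inv_smul_eq_iff₀ (hζ j)] at key
  rw [key, smul_comm, smul_inv_smul₀ (hζ i₁)]

variable {δ : Alg (copiesLattice i₀ (fun i => ζ i) L₀) →ₗ[ℂ] (Copies ι H →L[ℂ] Copies ι H)}

theorem IsLocalDerivation.defect_apply_mem_diagonal [CompleteSpace H] [LocallyFiniteOrderBot ι]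
    (h : IsLocalDerivation δ) (hi₀ : ∀ j, i₀ ≤ j) (hi₁ : i₁ ≠ i₀) (hζ : ∀ i, ζ i ≠ 0)
    (hL₀ : IsSubspaceLattice L₀) (hrank : rankOneSpan (Alg L₀) ≤ idempotentSpan (Alg L₀))
    (hpred : ∀ P ∈ L₀, P ≠ ⊥ → ¬ P < predecessor L₀ P)
    (a : Alg (copiesLattice i₀ (fun i => ζ i) L₀)) {k : Alg (copiesLattice i₀ (fun i => ζ i) L₀)}
    (hk : (k : Copies ι H →L[ℂ] Copies ι H) ∈
      idempotentSpan (Alg (copiesLattice i₀ (fun i => ζ i) L₀))) (w : Copies ι H) :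
    defect δ a k w ∈ diagonal (fun i => ζ i) := by
  have htop := hL₀.top_mem
  obtain ⟨ha1, ha2, -⟩ := (mem_Alg_copiesLattice_iff hi₀ htop).1 a.2
  refine mem_diagonal_of_forall_functional hi₀ hi₁ hζ hL₀ hpred (fun l φ hφ => ?_)
    fun P hP hP0 φ hd hp => ?_
  · by_cases hH : ∃ z : H, z ≠ 0
    · obtain ⟨z, hz⟩ := hH
      have hmem : incl l z ∈ initialSum l := incl_mem_initialSum le_rfl z
      refine h.apply_defect_eq_zero hk (u := incl l z) (fun h0 => hz ?_)
        (hφ.smulRight_mem_idempotentSpan hi₀ htop hmem)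
        ((hφ.comp hi₀ htop a.2).smulRight_mem_idempotentSpan hi₀ htop hmem) w
      rw [← incl_apply_self l z, h0]
      rfl
    · push Not at hH
      have : defect δ a k w = 0 := by
        ext i
        exact hH _
      rw [this, map_zero]
  · obtain ⟨x, hx, hx0⟩ : ∃ x ∈ P, x ≠ 0 := by
      by_contra! hc
      exact hP0 (le_bot_iff.1 fun x hx => hc x hx)
    refine h.apply_defect_eq_zero hk (u := incl i₀ x) (fun h0 => hx0 ?_)
      (smulRight_incl_mem_idempotentSpan hi₀ htop hi₁ hζ hrank hx hd hp)
      (smulRight_incl_mem_idempotentSpan hi₀ htop hi₁ hζ hrank hx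
        (fun v hv => hd _ (ha2 v hv)) fun y hy => ?_) w
    · rw [← incl_apply_self i₀ x, h0]
      rfl
    · have h3 := ha1 _ (predecessor_mem hL₀ P) _ (incl_mem_firstCopy hy)
      have h4 : (a : Copies ι H →L[ℂ] Copies ι H) (incl i₀ y) =
          incl i₀ ((a : Copies ι H →L[ℂ] Copies ι H) (incl i₀ y) i₀) := by
        ext j
        by_cases hj : j = i₀
        · rw [hj, incl_apply_self]
        · rw [incl_apply_ne hj, h3.2 j hj]
      rw [ContinuousLinearMap.comp_apply, h4]
      exact hp _ h3.1

/-! ### Ampliations and the Leibniz rule -/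

/-- The representation of the operators on `H` in the algebra: `T` acts in every coordinate except
the first, whose row is `(0, (ζ i₀ / ζ i₁) T, 0, …)`. -/
noncomputable def ampliation (i₀ i₁ : ι) (ζ : Copies ι ℂ) :
    (H →L[ℂ] H) →ₗ[ℂ] (Copies ι H →L[ℂ] Copies ι H) where
  toFun T := mapCopies T - cornerLift i₀ i₁ ζ T
  map_add' S T := by
    rw [map_add, show mapCopies (ι := ι) (S + T) = mapCopies S + mapCopies T from rfl]
    abel
  map_smul' c T := by
    rw [map_smul, show mapCopies (ι := ι) (c • T) = c • mapCopies T from rfl, smul_sub]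
    rfl

theorem ampliation_apply_of_ne {i : ι} (hi : i ≠ i₀) (T : H →L[ℂ] H) (v : Copies ι H) :
    ampliation i₀ i₁ ζ T v i = T (v i) := by
  change T (v i) - cornerLift i₀ i₁ ζ T v i = _
  rw [cornerLift_apply, incl_apply_ne hi, sub_zero]

theorem ampliation_apply_self (T : H →L[ℂ] H) (v : Copies ι H) :
    ampliation i₀ i₁ ζ T v i₀ = (ζ i₀ / ζ i₁) • T (v i₁) := by
  change T (v i₀) - cornerLift i₀ i₁ ζ T v i₀ = _
  rw [cornerLift_apply, incl_apply_self, map_sub, map_smul, sub_sub_cancel]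

theorem ampliation_mem_idempotentSpan (hi₀ : ∀ j, i₀ ≤ j) (htop : ⊤ ∈ L₀) (hi₁ : i₁ ≠ i₀)
    (hζ : ∀ i, ζ i ≠ 0) {T : H →L[ℂ] H}
    (hT : T ∈ idempotentSpan (⊤ : Subalgebra ℂ (H →L[ℂ] H))) :
    ampliation i₀ i₁ ζ T ∈ idempotentSpan (Alg (copiesLattice i₀ (fun i => ζ i) L₀)) := by
  induction hT using Submodule.span_induction with
  | mem T hT =>
    have hTT : ∀ x, T (T x) = T x := fun x => DFunLike.congr_fun hT.2.eq x
    refine mem_idempotentSpan_of_isIdempotentElem ?_ ?_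
    · refine (mem_Alg_copiesLattice_iff hi₀ htop).2
        ⟨fun P hP v hv => ?_, fun v hv => ?_, fun k v hv j hj => ?_⟩
      · refine ⟨?_, fun j hj => ?_⟩
        · rw [ampliation_apply_self, hv.2 i₁ hi₁, map_zero, smul_zero]
          exact P.toSubmodule.zero_mem
        · rw [ampliation_apply_of_ne hj, hv.2 j hj, map_zero]
      · rw [mem_diagonal_iff (hζ i₁)] at hv ⊢
        intro j
        rw [ampliation_apply_of_ne hi₁]
        by_cases hj : j = i₀
        · rw [hj, ampliation_apply_self, smul_smul, mul_div_cancel₀ _ (hζ i₁)]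
        · rw [ampliation_apply_of_ne hj, ← map_smul, hv j, map_smul]
      · rw [ampliation_apply_of_ne ((hi₀ k).trans_lt hj).ne', hv j hj, map_zero]
    · ext v i
      rw [mul_apply_eq_comp]
      by_cases hi : i = i₀
      · rw [hi, ampliation_apply_self, ampliation_apply_self, ampliation_apply_of_ne hi₁, hTT]
      · rw [ampliation_apply_of_ne hi, ampliation_apply_of_ne hi, hTT]
  | zero => simp
  | add x y _ _ hx hy => rw [map_add]; exact Submodule.add_mem _ hx hy
  | smul c x _ hx => rw [map_smul]; exact Submodule.smul_mem _ c hx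

/-- The rows of `A a - A'`, where `A` and `A'` are the ampliations of `x ⊗ ψ` and `x ⊗ χ`
and `χ` is chosen so that the difference annihilates the diagonal. -/
theorem exists_rows (hi₀ : ∀ j, i₀ ≤ j) (htop : ⊤ ∈ L₀) (hi₁ : i₁ ≠ i₀)
    (hζ : ∀ i, ζ i ≠ 0) {a : Copies ι H →L[ℂ] Copies ι H}
    (ha : a ∈ Alg (copiesLattice i₀ (fun i => ζ i) L₀)) (ψ : H →L[ℂ] ℂ) (x : H) :
    ∃ (χ : H →L[ℂ] ℂ) (g : ι → Copies ι H →L[ℂ] ℂ), (∀ i, KillsBelow i₀ ζ i (g i)) ∧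
      ∀ v i, (ampliation i₀ i₁ ζ (ψ.smulRight x) * a - ampliation i₀ i₁ ζ (χ.smulRight x)) v i =
        g i v • x := by
  obtain ⟨-, ha2, ha3⟩ := (mem_Alg_copiesLattice_iff hi₀ htop).1 ha
  set χ : H →L[ℂ] ℂ := (ζ i₁)⁻¹ • ψ.comp ((coord i₁).comp (a.comp (diagEmb ζ))) with hχ
  set f : ι → Copies ι H →L[ℂ] ℂ := fun i => ψ.comp ((coord i).comp a) - χ.comp (coord i) with hf
  have hf_apply : ∀ i v, f i v = ψ (a v i) - χ (v i) := fun _ _ => rfl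
  have hf_diag : ∀ i, ∀ v ∈ diagonal (fun i => ζ i), f i v = 0 := by
    intro i v hv
    obtain ⟨y, rfl⟩ : ∃ y, v = diagEmb ζ y := ⟨_, eq_diagEmb_of_mem_diagonal (hζ i) hv⟩
    have h1 := (mem_diagonal_iff (hζ i₁)).1 (ha2 _ hv) i
    have h2 : χ y = (ζ i₁)⁻¹ • ψ (a (diagEmb ζ y) i₁) := rfl
    rw [hf_apply, diagEmb_apply, map_smul, h2, smul_comm (ζ i), ← map_smul ψ, ← h1, map_smul,
      inv_smul_smul₀ (hζ i₁), sub_self]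
  have hf_below : ∀ i k, k < i → ∀ v ∈ initialSum k, f i v = 0 := by
    intro i k hk v hv
    rw [hf_apply, hv i hk, ha3 k v hv i hk, map_zero, map_zero, sub_zero]
  refine ⟨χ, fun i => if i = i₀ then (ζ i₀ / ζ i₁) • f i₁ else f i, fun i => ?_, fun v i => ?_⟩
  · by_cases hi : i = i₀
    · subst hi
      simp only [if_true]
      refine ⟨fun v hv => ?_, fun v hv => ?_, fun k hk => absurd hk (hi₀ k).not_gt⟩
      · rw [smul_apply, hf_diag i₁ v hv, smul_zero]
      · rw [smul_apply, hf_below i₁ i (lt_of_le_of_ne (hi₀ i₁) hi₁.symm) v hv, smul_zero]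
    · simp only [if_neg hi]
      exact ⟨hf_diag i, hf_below i i₀ (lt_of_le_of_ne (hi₀ i) (Ne.symm hi)), hf_below i⟩
  · change ampliation i₀ i₁ ζ (ψ.smulRight x) (a v) i - ampliation i₀ i₁ ζ (χ.smulRight x) v i = _
    by_cases hi : i = i₀
    · subst hi
      simp only [if_true]
      rw [ampliation_apply_self, ampliation_apply_self, ← smul_sub, smul_apply, hf_apply,
        smul_assoc, sub_smul]
      rfl
    · simp only [if_neg hi]
      rw [ampliation_apply_of_ne hi, ampliation_apply_of_ne hi, hf_apply, sub_smul]
      rfl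

/-- The Leibniz rule for `(a, k)` when `k` is a combination of idempotents with range in some `F_m`.
The defect has range in the diagonal, so it suffices to multiply it by ampliations `A` of rank-one
operators, that is, to replace `a` by `A a`. Modulo combinations of idempotents, `A a` may be
replaced by an operator `c` whose rows up to the `m`-th vanish. Then `c k = 0`, so the defect
factors through `c`, and its range consists of diagonal vectors with vanishing first coordinate. -/
theorem IsLocalDerivation.defect_eq_zero_of_range_subset_initialSum [CompleteSpace H]
    [LocallyFiniteOrderBot ι] (h : IsLocalDerivation δ) (hi₀ : ∀ j, i₀ ≤ j) (hi₁ : i₁ ≠ i₀)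
    (hζ : ∀ i, ζ i ≠ 0) (hL₀ : IsSubspaceLattice L₀)
    (hrank : rankOneSpan (Alg L₀) ≤ idempotentSpan (Alg L₀))
    (hpred : ∀ P ∈ L₀, P ≠ ⊥ → ¬ P < predecessor L₀ P)
    (a : Alg (copiesLattice i₀ (fun i => ζ i) L₀)) {k : Alg (copiesLattice i₀ (fun i => ζ i) L₀)}
    (hk : (k : Copies ι H →L[ℂ] Copies ι H) ∈
      idempotentSpan (Alg (copiesLattice i₀ (fun i => ζ i) L₀))) {m : ι}
    (hm : ∀ w, (k : Copies ι H →L[ℂ] Copies ι H) w ∈ initialSum m) :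
    defect δ a k = 0 := by
  have htop := hL₀.top_mem
  have hdiag := h.defect_apply_mem_diagonal hi₀ hi₁ hζ hL₀ hrank hpred
  have hampl : ∀ (ψ : H →L[ℂ] ℂ) (x : H), ampliation i₀ i₁ ζ (ψ.smulRight x) ∈
      idempotentSpan (Alg (copiesLattice i₀ (fun i => ζ i) L₀)) := fun ψ x =>
    ampliation_mem_idempotentSpan hi₀ htop hi₁ hζ (smulRight_mem_idempotentSpan_top ψ x)
  have key : ∀ (ψ : H →L[ℂ] ℂ) (x : H),
      ampliation i₀ i₁ ζ (ψ.smulRight x) * defect δ a k = 0 := by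
    intro ψ x
    let A : Alg (copiesLattice i₀ (fun i => ζ i) L₀) := ⟨_, idempotentSpan_le (hampl ψ x)⟩
    obtain ⟨χ, g, hg, hrow⟩ := exists_rows hi₀ htop hi₁ hζ a.2 ψ x
    let B : Alg (copiesLattice i₀ (fun i => ζ i) L₀) := ⟨_, idempotentSpan_le (hampl χ x)⟩
    have hGmem : ∑ i ∈ Finset.Iic m, (g i).smulRight (incl i x) ∈
        idempotentSpan (Alg (copiesLattice i₀ (fun i => ζ i) L₀)) :=
      Submodule.sum_mem _ fun i _ =>
        (hg i).smulRight_mem_idempotentSpan hi₀ htop (incl_mem_initialSum le_rfl x)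
    let G : Alg (copiesLattice i₀ (fun i => ζ i) L₀) := ⟨_, idempotentSpan_le hGmem⟩
    have hG_apply : ∀ v, (G : Copies ι H →L[ℂ] Copies ι H) v =
        ∑ i ∈ Finset.Iic m, incl i (g i v • x) := by
      intro v
      change (∑ i ∈ Finset.Iic m, (g i).smulRight (incl i x)) v = _
      rw [sum_apply]
      exact Finset.sum_congr rfl fun i _ => (map_smul (incl i) (g i v) x).symm
    set c := A * a - B - G with hc
    have hc_apply : ∀ v, (c : Copies ι H →L[ℂ] Copies ι H) v =
        ((A * a - B : Alg (copiesLattice i₀ (fun i => ζ i) L₀)) :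
          Copies ι H →L[ℂ] Copies ι H) v - (G : Copies ι H →L[ℂ] Copies ι H) v :=
      fun _ => rfl
    have hrow' : ∀ v i, ((A * a - B : Alg (copiesLattice i₀ (fun i => ζ i) L₀)) :
        Copies ι H →L[ℂ] Copies ι H) v i = g i v • x := hrow
    have hck : c * k = 0 := by
      ext1
      ext1 w
      change (c : Copies ι H →L[ℂ] Copies ι H) ((k : Copies ι H →L[ℂ] Copies ι H) w) = 0
      rw [hc_apply, hG_apply, sub_eq_zero]
      have := eq_sum_incl_of_mem_initialSum
        (((mem_Alg_copiesLattice_iff hi₀ htop).1 (A * a - B).2).2.2 m _ (hm w))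
      simpa only [hrow'] using this
    have hc0 : ∀ v, (c : Copies ι H →L[ℂ] Copies ι H) v i₀ = 0 := by
      intro v
      have hGi : (G : Copies ι H →L[ℂ] Copies ι H) v i₀ = g i₀ v • x := by
        rw [hG_apply, ← coord_apply, map_sum, Finset.sum_eq_single i₀]
        · rw [coord_apply, incl_apply_self]
        · intro j _ hj
          rw [coord_apply, incl_apply_ne hj.symm]
        · intro hn
          exact absurd (Finset.mem_Iic.2 (hi₀ m)) hn
      rw [hc_apply, lp.coeFn_sub, Pi.sub_apply, hrow', hGi, sub_self]
    have hcdef : defect δ c k = 0 := by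
      obtain ⟨R, hR⟩ := h.exists_defect_eq_mul hck
      ext1 w
      refine eq_zero_of_mem_diagonal hζ (hdiag c hk w) (i := i₀) ?_
      rw [hR]
      exact hc0 (R w)
    have e : A * a = c + G + B := by rw [hc]; abel
    have h1 := h.mul_defect (p := A) (hampl ψ x) hk a
    rw [e, defect_add, defect_add, hcdef, h.defect_eq_zero (p := G) hGmem hk,
      h.defect_eq_zero (p := B) (hampl χ x) hk, add_zero, add_zero] at h1
    exact h1
  ext1 w
  refine eq_zero_of_mem_diagonal hζ (hdiag a hk w) (i := i₁) ?_
  refine SeparatingDual.eq_zero_of_forall_dual_eq_zero (R := ℂ) fun ψ => ?_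
  have h1 : ψ (defect δ a k w i₁) • defect δ a k w i₁ = 0 := by
    have := congrArg (fun v : Copies ι H => v i₁)
      (DFunLike.congr_fun (key ψ (defect δ a k w i₁)) w)
    simp only [mul_apply_eq_comp, ampliation_apply_of_ne hi₁] at this
    exact this
  rcases smul_eq_zero.1 h1 with h2 | h2
  · exact h2
  · rw [h2, map_zero]

/-- Local derivations are derivations, for every index set with a least element, a further element
and finite initial segments. The rank-one operators `u ⊗ φ` in the algebra whose left factor lies in
some `F_m` have total range, and by the previous theorem they satisfy
`isDerivation_of_defect_eq_zero`. -/
theorem IsLocalDerivation.isDerivation_of_copiesLattice [CompleteSpace H]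
    [LocallyFiniteOrderBot ι] (h : IsLocalDerivation δ) (hi₀ : ∀ j, i₀ ≤ j) (hi₁ : i₁ ≠ i₀)
    (hζ : ∀ i, ζ i ≠ 0) (hL₀ : IsSubspaceLattice L₀)
    (hrank : rankOneSpan (Alg L₀) ≤ idempotentSpan (Alg L₀))
    (hpred : ∀ P ∈ L₀, P ≠ ⊥ → ¬ P < predecessor L₀ P) : IsDerivation δ := by
  have htop := hL₀.top_mem
  set 𝒜 := Alg (copiesLattice i₀ (fun i => ζ i) L₀)
  have hinv : ∀ b : 𝒜, _ := fun b => (mem_Alg_copiesLattice_iff hi₀ htop).1 b.2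
  let J : Set 𝒜 := {k | (∀ b : 𝒜, ((b * k : 𝒜) : Copies ι H →L[ℂ] Copies ι H) ∈
    idempotentSpan 𝒜) ∧ ∃ m, ∀ w, (k : Copies ι H →L[ℂ] Copies ι H) w ∈ initialSum m}
  have hJ : ∀ (φ : Copies ι H →L[ℂ] ℂ) (u : Copies ι H) (m : ι), u ∈ initialSum m →
      (∀ b : 𝒜, φ.smulRight ((b : Copies ι H →L[ℂ] Copies ι H) u) ∈ idempotentSpan 𝒜) →
      ∃ k ∈ J, (k : Copies ι H →L[ℂ] Copies ι H) = φ.smulRight u := by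
    intro φ u m hu hb
    refine ⟨⟨φ.smulRight u, idempotentSpan_le (hb 1)⟩, ⟨fun b => ?_, m, fun w => ?_⟩, rfl⟩
    · have e : ((b * ⟨φ.smulRight u, idempotentSpan_le (hb 1)⟩ : 𝒜) :
          Copies ι H →L[ℂ] Copies ι H) =
          φ.smulRight ((b : Copies ι H →L[ℂ] Copies ι H) u) := by
        ext1 w
        exact map_smul (b : Copies ι H →L[ℂ] Copies ι H) (φ w) u
      rw [e]
      exact hb b
    · exact (initialSum m).toSubmodule.smul_mem _ hu
  refine isDerivation_of_defect_eq_zero J ?_ ?_ fun M hM => ?_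
  · rintro b k ⟨hk, m, hm⟩
    exact ⟨fun b' => by rw [← mul_assoc]; exact hk _, m, fun w => (hinv b).2.2 m _ (hm w)⟩
  · rintro a k ⟨hk, m, hm⟩
    have hk1 := hk 1
    rw [one_mul] at hk1
    exact h.defect_eq_zero_of_range_subset_initialSum hi₀ hi₁ hζ hL₀ hrank hpred a hk1 hm
  -- An operator annihilating `J` annihilates the left factor `u` of every `u ⊗ φ ∈ J`.
  have hMu : ∀ (φ : Copies ι H →L[ℂ] ℂ) (u : Copies ι H) (m : ι), u ∈ initialSum m →
      (∀ b : 𝒜, φ.smulRight ((b : Copies ι H →L[ℂ] Copies ι H) u) ∈ idempotentSpan 𝒜) →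
      ∀ w, φ w ≠ 0 → M u = 0 := by
    intro φ u m hu hb w hw
    obtain ⟨k, hk, e⟩ := hJ φ u m hu hb
    have := DFunLike.congr_fun (hM k hk) w
    rw [e] at this
    have h1 : φ w • M u = 0 := by rw [← map_smul]; exact this
    exact (smul_eq_zero.1 h1).resolve_left hw
  have hfirst : ∀ x, M (incl i₀ x) = 0 := by
    have hle : sSup {P | P ∈ L₀ ∧ predecessor L₀ P ≠ ⊤} ≤
        (⊥ : ClosedSubmodule ℂ (Copies ι H)).comap (M.comp (incl i₀)) := by
      refine sSup_le ?_
      rintro P ⟨hP, hne⟩ x hx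
      obtain ⟨y, hy⟩ : ∃ y, y ∉ predecessor L₀ P := by
        by_contra! hc
        exact hne (top_le_iff.1 fun y _ => hc y)
      obtain ⟨ψ, hψ, hψy⟩ := exists_functional_ne_zero hy
      refine hMu (ψ.comp (quotSub ζ i₀ i₁)) (incl i₀ x) i₀ (incl_mem_initialSum le_rfl x)
        (fun b => ?_) (incl i₀ y) ?_
      · have h3 := (hinv b).1 P hP _ (incl_mem_firstCopy hx)
        have h4 : (b : Copies ι H →L[ℂ] Copies ι H) (incl i₀ x) =
            incl i₀ ((b : Copies ι H →L[ℂ] Copies ι H) (incl i₀ x) i₀) := by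
          ext j
          by_cases hj : j = i₀
          · rw [hj, incl_apply_self]
          · rw [incl_apply_ne hj, h3.2 j hj]
        rw [h4]
        refine smulRight_incl_mem_idempotentSpan hi₀ htop hi₁ hζ hrank h3.1 (fun v hv => ?_)
          fun y hy => ?_
        · rw [ContinuousLinearMap.comp_apply, quotSub_eq_zero_of_mem_diagonal hζ i₀ i₁ hv, map_zero]
        · rw [ContinuousLinearMap.comp_apply, quotSub_incl hi₁, map_smul, hψ y hy, smul_zero]
      · rw [ContinuousLinearMap.comp_apply, quotSub_incl hi₁, map_smul]
        exact smul_ne_zero (inv_ne_zero (hζ i₀)) hψy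
    rw [sSup_predecessor_ne_top_eq_top hL₀ hpred] at hle
    exact fun x => hle ClosedSubmodule.mem_top
  have hnotlast : ∀ j l, j < l → ∀ x, M (incl j x) = 0 := by
    intro j l hjl x
    rcases (hi₀ j).eq_or_lt with rfl | hj
    · exact hfirst x
    by_cases hx : x = 0
    · rw [hx, map_zero, map_zero]
    obtain ⟨ψ, hψ⟩ := SeparatingDual.exists_ne_zero (R := ℂ) hx
    refine hMu (ψ.comp (quotSub ζ j l)) (incl j x) j (incl_mem_initialSum le_rfl x)
      (fun b => ?_) (incl j x) ?_
    · exact (killsBelow_comp_quotSub hζ hj hjl ψ).smulRight_mem_idempotentSpan hi₀ htop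
        ((hinv b).2.2 j _ (incl_mem_initialSum le_rfl x))
    · rw [ContinuousLinearMap.comp_apply, quotSub_incl hjl.ne', map_smul]
      exact smul_ne_zero (inv_ne_zero (hζ j)) hψ
  refine eq_zero_of_forall_incl fun N x => ?_
  by_cases hlast : ∃ l, N < l
  · obtain ⟨l, hl⟩ := hlast
    exact hnotlast N l hl x
  push Not at hlast
  have hN : i₀ < N := (lt_of_le_of_ne (hi₀ i₁) hi₁.symm).trans_le (hlast i₁)
  by_cases hx : x = 0
  · rw [hx, map_zero, map_zero]
  obtain ⟨ψ, hψ⟩ := SeparatingDual.exists_ne_zero (R := ℂ) hx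
  have hMd : M (diagEmb ζ x) = 0 := by
    refine hMu (ψ.comp (coord N)) (diagEmb ζ x) N (fun j hj => absurd hj (hlast j).not_gt)
      (fun b => ?_) (incl N x) ?_
    · exact smulRight_mem_idempotentSpan_of_last hi₀ htop hN (hζ N) ψ hlast
        ((hinv b).2.1 _ (diagEmb_mem_diagonal ζ x))
    · rwa [ContinuousLinearMap.comp_apply, coord_apply, incl_apply_self]
  -- Only the last summand contributes to `M (diagEmb ζ x)`.
  have h1 := (hasSum_incl (diagEmb ζ x)).mapL M
  have h2 := h1.unique (hasSum_single N fun j hj =>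
    hnotlast j N (lt_of_le_of_ne (hlast j) hj) _)
  rw [hMd, diagEmb_apply, map_smul, map_smul] at h2
  exact (smul_eq_zero.1 h2.symm).resolve_left (hζ N)

end Defects

end LocalDer

theorem mainTheorem1 {H : Type*} [NormedAddCommGroup H] [InnerProductSpace ℂ H] [CompleteSpace H]
    (L₀ : Set (ClosedSubmodule ℂ H))
    (hL₀ : LocalDer.IsSubspaceLattice L₀)
    (hrefl : LocalDer.IsReflexiveLattice L₀)
    (hdec : LocalDer.IsDecomposable (LocalDer.Alg L₀))
    (hrank : LocalDer.rankOneSpan (LocalDer.Alg L₀) ≤ LocalDer.idempotentSpan (LocalDer.Alg L₀))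
    (hpred : ∀ P ∈ L₀, P ≠ ⊥ → ¬ P < LocalDer.predecessor L₀ P) :
    (∀ (n₀ : ℕ) (hn₀ : 2 ≤ n₀) (ζ : LocalDer.Copies (Fin n₀) ℂ), ‖ζ‖ = 1 → (∀ i, ζ i ≠ 0) →
      ∀ δ : LocalDer.Alg (LocalDer.copiesLattice (⟨0, by omega⟩ : Fin n₀) (fun i => ζ i) L₀) →ₗ[ℂ]
          (LocalDer.Copies (Fin n₀) H →L[ℂ] LocalDer.Copies (Fin n₀) H),
        LocalDer.IsLocalDerivation δ → LocalDer.IsDerivation δ) ∧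
    (∀ η : LocalDer.Copies ℕ ℂ, ‖η‖ = 1 → (∀ i, η i ≠ 0) →
      ∀ δ : LocalDer.Alg (LocalDer.copiesLattice (0 : ℕ) (fun i => η i) L₀) →ₗ[ℂ]
          (LocalDer.Copies ℕ H →L[ℂ] LocalDer.Copies ℕ H),
        LocalDer.IsLocalDerivation δ → LocalDer.IsDerivation δ) := by
  refine ⟨fun n₀ hn₀ ζ _ hζ δ hδ => ?_, fun η _ hη δ hδ => ?_⟩
  · exact hδ.isDerivation_of_copiesLattice (i₁ := ⟨1, by omega⟩) (fun j => Nat.zero_le j)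
      (fun h => one_ne_zero (congrArg Fin.val h)) hζ hL₀ hrank hpred
  · exact hδ.isDerivation_of_copiesLattice (i₁ := 1) (fun j => Nat.zero_le j) one_ne_zero hη hL₀
      hrank hpred
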